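/- Let $A_0,\dots,A_m\in\mathbb{R}^{n\times n}$, $a_0,\dots,a_m\in\mathbb{R}^n$, let $\Omega\subset\mathbb{R}^m$ be a convex and compact neighborhood of $0$, and let $\mathcal{U}=\{u\in L^\infty(\mathbb{R},\mathbb{R}^m) : u(t)\in\Omega\text{ for almost all }t\}$. Consider the affine control system on $\mathbb{R}^n$ (with the metric of the maximum norm) $$\dot x(t)=A_0x(t)+a_0+\sum_{i=1}^m u_i(t)\,[A_ix(t)+a_i],\qquad u\in\mathcal{U}, \qquad (1)$$ and, with $A_i'=\begin{pmatrix}A_i&a_i\\0&0\end{pmatrix}$, the induced control system $$\dot s=[A_0'-s^{T}A_0's\cdot I]\,s+\sum_{i=1}^m u_i(t)\,[A_i'-s^{T}A_i's\cdot I]\,s,\qquad u\in\mathcal{U}, \qquad (2)$$ on the open northern hemisphere $\mathbb{S}^{n,+}=\{s\in\mathbb{R}^{n+1}:\sum_{i=1}^{n+1}s_i^2=1,\ s_{n+1}>0\}$ of the Poincaré sphere, with the metric $d(s,s')=\max_i|s_i-s_i'|$. Solutions are understood in the sense of Carathéodory, on all of $\mathbb{R}$. For a control system on a metric space $(M,d)$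 with trajectories $\varphi(t,x,u)$, $t\in\mathbb{R}$, a point $x\in M$ is called strongly chain controllable to $y\in M$ if for every continuous function $\varepsilon:M\to(0,\infty)$ and every $T>0$ there are $k\ge 1$, points $x_0=x,x_1,\dots,x_k=y$ in $M$, controls $u_0,\dots,u_{k-1}\in\mathcal{U}$ and times $T_0,\dots,T_{k-1}\ge T$ with $$d(\varphi(T_j,x_j,u_j),x_{j+1})<\varepsilon(\varphi(T_j,x_j,u_j)),\qquad j=0,\dots,k-1.$$ A nonvoid set $E^*\subset M$ is a strong chain control set if (i) every $x\in E^*$ is strongly chain controllable to every $y\in E^*$, (ii) for every $x\in E^*$ there is $u\in\mathcal{U}$ with $\varphi(t,x,u)\in E^*$ for all $t\in\mathbb{R}$, and (iii) $E^*$ is maximal (with respect to inclusion) with these properties. Let $h:\mathbb{R}^n\to\mathbb{S}^{n,+}$, $h(x)=(x,1)/\|(x,1)\|$, with the Euclidean norm. Then the strong chain control sets of (2) on $\mathbb{S}^{n,+}$ are exactly the sets $h(E^*)$, where $E^*$ runs through the strong chain control sets of (1) on $\mathbb{R}^n$. -/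

import Mathlib

open MeasureTheory

noncomputable section

/-- The set of admissible controls: all `u ∈ L^∞(ℝ, ℝ^m)` with `u(t) ∈ Ω` for almost all `t`. -/
def Controls {m : ℕ} (Ω : Set (Fin m → ℝ)) : Set (Lp (Fin m → ℝ) ⊤ (volume : Measure ℝ)) :=
  {u | ∀ᵐ t : ℝ, u t ∈ Ω}

/-- `γ : ℝ → ℝ^N` is a (global) Carathéodory solution of
`γ'(t) = X₀(γ(t)) + ∑ i, u_i(t) X_i(γ(t))`: it is locally absolutely continuous and
satisfies the equation for almost all `t`. -/
def IsSolution {m N : ℕ} (X₀ : (Fin N → ℝ) → (Fin N → ℝ))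
    (X : Fin m → (Fin N → ℝ) → (Fin N → ℝ))
    (u : Lp (Fin m → ℝ) ⊤ (volume : Measure ℝ)) (γ : ℝ → Fin N → ℝ) : Prop :=
  (∀ a b : ℝ, AbsolutelyContinuousOnInterval γ a b) ∧
    ∀ᵐ t : ℝ, HasDerivAt γ (X₀ (γ t) + ∑ i, u t i • X i (γ t)) t

section Chains

/-! In this section a control system on a metric space `M` with controls in `U` is given by
its trajectories: `Traj u γ` means that `γ : ℝ → M` is a trajectory for the control `u`, i.e.
`γ t = φ(t, γ 0, u)` for all `t`. -/

variable {M U : Type*} [MetricSpace M]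

/-- There is a controlled `(ε, T)`-chain from `x` to `y`, where `ε` is a jump function. -/
def HasControlledChain (Traj : U → (ℝ → M) → Prop) (ε : M → ℝ) (T : ℝ) (x y : M) : Prop :=
  ∃ (k : ℕ) (τ : ℕ → ℝ) (u : ℕ → U) (p : ℕ → M),
    1 ≤ k ∧ p 0 = x ∧ p k = y ∧
    ∀ j < k, T ≤ τ j ∧
      ∃ γ : ℝ → M, Traj (u j) γ ∧ γ 0 = p j ∧ dist (γ (τ j)) (p (j + 1)) < ε (γ (τ j))

/-- `x` is strongly chain controllable to `y`: for every continuous jump function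
`ε : M → (0, ∞)` and every `T > 0` there is a controlled `(ε, T)`-chain from `x` to `y`. -/
def StronglyChainControllable (Traj : U → (ℝ → M) → Prop) (x y : M) : Prop :=
  ∀ ε : M → ℝ, Continuous ε → (∀ z, 0 < ε z) → ∀ T : ℝ, 0 < T →
    HasControlledChain Traj ε T x y

/-- A strong chain control set: a nonvoid set `E` such that (i) every point of `E` is strongly
chain controllable to every point of `E`, (ii) through every point of `E` there is a full
trajectory, for some control, that stays in `E`, and (iii) `E` is maximal with these properties. -/
def IsStrongChainControlSet (Traj : U → (ℝ → M) → Prop) (E : Set M) : Prop :=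
  Maximal (fun F : Set M => F.Nonempty ∧
    (∀ x ∈ F, ∀ y ∈ F, StronglyChainControllable Traj x y) ∧
    (∀ x ∈ F, ∃ (u : U) (γ : ℝ → M), Traj u γ ∧ γ 0 = x ∧ ∀ t, γ t ∈ F)) E

end Chains

/-- Trajectories of the affine control system
`x' = A₀ x + a₀ + ∑ i, u_i(t) (A_i x + a_i)` on `ℝ^n` with controls in `Controls Ω`. -/
def AffineTraj {n m : ℕ} (Ω : Set (Fin m → ℝ))
    (A₀ : Matrix (Fin n) (Fin n) ℝ) (a₀ : Fin n → ℝ)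
    (A : Fin m → Matrix (Fin n) (Fin n) ℝ) (a : Fin m → Fin n → ℝ)
    (u : Controls Ω) (γ : ℝ → Fin n → ℝ) : Prop :=
  IsSolution (fun x => A₀.mulVec x + a₀) (fun i x => (A i).mulVec x + a i) u.1 γ

/-- The vector `(x, z) ∈ ℝ^(n+1)` for `x ∈ ℝ^n`, `z ∈ ℝ`. -/
def extVec {n : ℕ} (x : Fin n → ℝ) (z : ℝ) : Fin (n + 1) → ℝ :=
  Fin.snoc (α := fun _ => ℝ) x z

/-- The block matrix `A' = [[A, a], [0, 0]]`. -/
def extMatrix {n : ℕ} (A : Matrix (Fin n) (Fin n) ℝ) (a : Fin n → ℝ) :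
    Matrix (Fin (n + 1)) (Fin (n + 1)) ℝ :=
  Matrix.of (Fin.snoc (α := fun _ => Fin (n + 1) → ℝ) (fun i => extVec (A i) (a i)) 0)

/-- The vector field `s ↦ [B - (sᵀ B s) I] s` obtained by projecting `y ↦ B y` to the sphere. -/
def sphereField {N : ℕ} (B : Matrix (Fin N) (Fin N) ℝ) (s : Fin N → ℝ) : Fin N → ℝ :=
  B.mulVec s - (s ⬝ᵥ B.mulVec s) • s

/-- The open northern hemisphere of the Poincaré sphere. As a subtype of `Fin (n+1) → ℝ` it
carries the metric `d(s, s') = max_i |s_i - s'_i|`. -/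
def NorthHemisphere (n : ℕ) : Set (Fin (n + 1) → ℝ) :=
  {s | ∑ i, s i ^ 2 = 1 ∧ 0 < s (Fin.last n)}

/-- Trajectories of the induced control system on the open northern hemisphere. -/
def HemisphereTraj {n m : ℕ} (Ω : Set (Fin m → ℝ))
    (A₀ : Matrix (Fin n) (Fin n) ℝ) (a₀ : Fin n → ℝ)
    (A : Fin m → Matrix (Fin n) (Fin n) ℝ) (a : Fin m → Fin n → ℝ)
    (u : Controls Ω) (γ : ℝ → NorthHemisphere n) : Prop :=
  IsSolution (sphereField (extMatrix A₀ a₀)) (fun i => sphereField (extMatrix (A i) (a i)))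
    u.1 (fun t => (γ t : Fin (n + 1) → ℝ))

/-- The Euclidean norm on `ℝ^N`. -/
def euclNorm {N : ℕ} (v : Fin N → ℝ) : ℝ := Real.sqrt (∑ i, v i ^ 2)

/-- `(x, 1) / ‖(x, 1)‖` lies in the open northern hemisphere. -/
theorem normalized_mem_northHemisphere {n : ℕ} (x : Fin n → ℝ) :
    (euclNorm (extVec x 1))⁻¹ • extVec x 1 ∈ NorthHemisphere n := by
  have hpos : 0 < ∑ i, extVec x 1 i ^ 2 := by
    rw [Fin.sum_univ_castSucc]
    simp only [extVec, Fin.snoc_castSucc, Fin.snoc_last]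
    positivity
  have hs : 0 < euclNorm (extVec x 1) := Real.sqrt_pos.2 hpos
  refine ⟨?_, ?_⟩
  · simp only [Pi.smul_apply, smul_eq_mul, mul_pow, ← Finset.mul_sum]
    rw [inv_pow, euclNorm, Real.sq_sqrt hpos.le]
    exact inv_mul_cancel₀ hpos.ne'
  · simpa [extVec] using hs

/-- The map `h : ℝ^n → S^{n,+}`, `h(x) = (x, 1) / ‖(x, 1)‖`. -/
def hemisphereMap {n : ℕ} (x : Fin n → ℝ) : NorthHemisphere n :=
  ⟨(euclNorm (extVec x 1))⁻¹ • extVec x 1, normalized_mem_northHemisphere x⟩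

end

/-!
A homeomorphism carrying the trajectories of one control system onto those of another also carries
strong chains to strong chains: a jump function `ε` on the target pulls back to a jump function `δ`
on the source with `dist x y < δ x → dist (f x) (f y) < ε (f x)`. With constant jump sizes this
would be uniform continuity, which the inverse of `h` lacks.

The map `h` is `x ↦ (x, 1)`, which relates the affine vector fields to linear ones, followed by the
radial projection, which relates linear vector fields to their tangential parts on the sphere. A
`C¹` map pushes Carathéodory solutions forward along related vector fields. By the chain rule the
inverse of `h`, the central projection, relates the fields in the opposite direction.
-/

open Set Filter Topology
open scoped Matrix

section Conjugacy

theorem exists_continuous_pos_forall_dist_lt_imp_mem {M : Type*} [PseudoMetricSpace M]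
    {V : Set (M × M)} (hV : IsOpen V) (hdiag : ∀ x, (x, x) ∈ V) :
    ∃ δ : M → ℝ, Continuous δ ∧ (∀ x, 0 < δ x) ∧ ∀ x y, dist x y < δ x → (x, y) ∈ V := by
  rcases Vᶜ.eq_empty_or_nonempty with hempty | hne
  · rw [compl_empty_iff] at hempty
    exact ⟨fun _ => 1, continuous_const, fun _ => one_pos, fun x y _ => hempty ▸ mem_univ (x, y)⟩
  · refine ⟨fun x => Metric.infDist (x, x) Vᶜ, by fun_prop, fun x => ?_, fun x y hxy => ?_⟩
    · exact (hV.isClosed_compl.notMem_iff_infDist_pos hne).1 (not_not_intro (hdiag x))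
    · refine notMem_compl_iff.1 (Metric.notMem_of_dist_lt_infDist (x := (x, x)) ?_)
      simpa [Prod.dist_eq, dist_nonneg.trans_lt hxy] using hxy

theorem exists_continuous_pos_modulus {M N : Type*} [PseudoMetricSpace M] [PseudoMetricSpace N]
    {f : M → N} (hf : Continuous f) {ε : N → ℝ} (hε : Continuous ε) (hpos : ∀ z, 0 < ε z) :
    ∃ δ : M → ℝ, Continuous δ ∧ (∀ x, 0 < δ x) ∧
      ∀ x y, dist x y < δ x → dist (f x) (f y) < ε (f x) :=
  exists_continuous_pos_forall_dist_lt_imp_mem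
    (V := {q | dist (f q.1) (f q.2) < ε (f q.1)})
    (isOpen_lt (by fun_prop) (by fun_prop)) fun x => by simpa using hpos (f x)

variable {M N U : Type*} [MetricSpace M] [MetricSpace N]
  {Traj : U → (ℝ → M) → Prop} {Traj' : U → (ℝ → N) → Prop} {f : M → N}

/-- The map `f` semiconjugates the control system given by `Traj` to the one given by `Traj'`:
it sends trajectories to trajectories with the same control. -/
def MapsTrajectories (Traj : U → (ℝ → M) → Prop) (Traj' : U → (ℝ → N) → Prop) (f : M → N) : Prop :=
  ∀ ⦃u γ⦄, Traj u γ → Traj' u (f ∘ γ)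

/-- The properties among whose maximal sets are the strong chain control sets: `E` is nonvoid,
strong chain controllability holds between any two of its points, and through every point of `E`
there is a full trajectory staying in `E`. -/
def IsStronglyChainTransitive (Traj : U → (ℝ → M) → Prop) (E : Set M) : Prop :=
  E.Nonempty ∧ (∀ x ∈ E, ∀ y ∈ E, StronglyChainControllable Traj x y) ∧
    ∀ x ∈ E, ∃ (u : U) (γ : ℝ → M), Traj u γ ∧ γ 0 = x ∧ ∀ t, γ t ∈ E

theorem isStrongChainControlSet_iff_maximal {E : Set M} :
    IsStrongChainControlSet Traj E ↔ Maximal (IsStronglyChainTransitive Traj) E :=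
  Iff.rfl

theorem StronglyChainControllable.map (hTraj : MapsTrajectories Traj Traj' f) (hf : Continuous f)
    {x y : M} (h : StronglyChainControllable Traj x y) :
    StronglyChainControllable Traj' (f x) (f y) := by
  intro ε hε hεpos T hT
  obtain ⟨δ, hδ, hδpos, hδε⟩ := exists_continuous_pos_modulus hf hε hεpos
  obtain ⟨k, τ, u, p, hk, hp0, hpk, hstep⟩ := h δ hδ hδpos T hT
  refine ⟨k, τ, u, f ∘ p, hk, congrArg f hp0, congrArg f hpk, fun j hj => ?_⟩
  obtain ⟨hτ, γ, hγ, hγ0, hjump⟩ := hstep j hj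
  exact ⟨hτ, f ∘ γ, hTraj hγ, congrArg f hγ0, hδε _ _ hjump⟩

theorem IsStronglyChainTransitive.image (hTraj : MapsTrajectories Traj Traj' f) (hf : Continuous f)
    {E : Set M} (h : IsStronglyChainTransitive Traj E) :
    IsStronglyChainTransitive Traj' (f '' E) := by
  obtain ⟨hne, hchain, hinv⟩ := h
  refine ⟨hne.image f, ?_, ?_⟩
  · rintro _ ⟨x, hx, rfl⟩ _ ⟨y, hy, rfl⟩
    exact (hchain x hx y hy).map hTraj hf
  · rintro _ ⟨x, hx, rfl⟩
    obtain ⟨u, γ, hγ, hγ0, hγE⟩ := hinv x hx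
    exact ⟨u, f ∘ γ, hTraj hγ, congrArg f hγ0, fun t => mem_image_of_mem f (hγE t)⟩

theorem IsStrongChainControlSet.image (e : M ≃ₜ N) (he : MapsTrajectories Traj Traj' e)
    (he' : MapsTrajectories Traj' Traj e.symm) {E : Set M}
    (hE : IsStrongChainControlSet Traj E) : IsStrongChainControlSet Traj' (e '' E) := by
  rw [isStrongChainControlSet_iff_maximal] at hE ⊢
  refine ⟨hE.prop.image he e.continuous, fun F hF hEF => ?_⟩
  have hsymm_image : IsStronglyChainTransitive Traj (e.symm '' F) :=
    hF.image he' e.symm.continuous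
  rw [e.image_symm] at hsymm_image
  have hFE : e ⁻¹' F ⊆ E := hE.le_of_ge hsymm_image (image_subset_iff.1 hEF)
  simpa only [e.image_preimage] using image_mono (f := e) hFE

theorem isStrongChainControlSet_iff_exists_image (e : M ≃ₜ N)
    (he : MapsTrajectories Traj Traj' e) (he' : MapsTrajectories Traj' Traj e.symm) (F : Set N) :
    IsStrongChainControlSet Traj' F ↔ ∃ E, IsStrongChainControlSet Traj E ∧ F = e '' E := by
  constructor
  · intro hF
    exact ⟨e.symm '' F, hF.image e.symm he' he, by rw [e.image_symm, e.image_preimage]⟩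
  · rintro ⟨E, hE, rfl⟩
    exact hE.image e he he'

end Conjugacy

section AbsoluteContinuity

variable {X Y : Type*} [PseudoMetricSpace Y]

theorem absolutelyContinuousOnInterval_comp_of_lipschitzOnWith [PseudoMetricSpace X]
    {f : ℝ → X} {g : X → Y} {a b : ℝ} {K : NNReal} (hg : LipschitzOnWith K g (f '' uIcc a b))
    (hf : AbsolutelyContinuousOnInterval f a b) :
    AbsolutelyContinuousOnInterval (g ∘ f) a b := by
  have hlim := Tendsto.const_mul (K : ℝ) hf
  rw [mul_zero] at hlim
  refine squeeze_zero' (Eventually.of_forall fun _ => Finset.sum_nonneg fun _ _ => dist_nonneg)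
    ?_ hlim
  rw [eventually_inf_principal]
  filter_upwards with I hI
  rw [Finset.mul_sum]
  gcongr with i hi
  exact hg.dist_le_mul _ (mem_image_of_mem f (hI.1 i hi).1) _ (mem_image_of_mem f (hI.1 i hi).2)

theorem absolutelyContinuousOnInterval_comp_of_locallyLipschitzOn [SeminormedAddCommGroup X]
    {f : ℝ → X} {g : X → Y} {a b : ℝ} (hg : LocallyLipschitzOn (f '' uIcc a b) g)
    (hf : AbsolutelyContinuousOnInterval f a b) :
    AbsolutelyContinuousOnInterval (g ∘ f) a b := by
  obtain ⟨K, hK⟩ :=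
    hg.exists_lipschitzOnWith_of_compact (isCompact_uIcc.image_of_continuousOn hf.continuousOn)
  exact absolutelyContinuousOnInterval_comp_of_lipschitzOnWith hK hf

end AbsoluteContinuity

section RelatedFields

variable {E F G : Type*} [NormedAddCommGroup E] [NormedSpace ℝ E]
  [NormedAddCommGroup F] [NormedSpace ℝ F] [NormedAddCommGroup G] [NormedSpace ℝ G]

theorem locallyLipschitzOn_of_contDiffAt {g : E → F} {s : Set E}
    (hg : ∀ x ∈ s, ContDiffAt ℝ 1 g x) : LocallyLipschitzOn s g := by
  intro x hx
  obtain ⟨K, t, ht, hK⟩ := (hg x hx).exists_lipschitzOnWith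
  exact ⟨K, t, mem_nhdsWithin_of_mem_nhds ht, hK⟩

/-- The vector fields `X` and `Y` are `g`-related at the points of `s`: the derivative of `g` maps
`X x` to `Y (g x)`. Where `g` is not differentiable `fderiv` is `0`, so this is meant for `g`
differentiable at the points of `s`. -/
def IsRelatedOn (g : E → F) (s : Set E) (X : E → E) (Y : F → F) : Prop :=
  ∀ x ∈ s, fderiv ℝ g x (X x) = Y (g x)

theorem IsRelatedOn.comp {g : E → F} {k : F → G} {s : Set E} {t : Set F} {X : E → E} {Y : F → F}
    {Z : G → G} (hk : IsRelatedOn k t Y Z) (hg : IsRelatedOn g s X Y) (hst : MapsTo g s t)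
    (hkd : ∀ y ∈ t, DifferentiableAt ℝ k y) (hgd : ∀ x ∈ s, DifferentiableAt ℝ g x) :
    IsRelatedOn (k ∘ g) s X Z := by
  intro x hx
  rw [fderiv_comp x (hkd _ (hst hx)) (hgd x hx), ContinuousLinearMap.comp_apply, hg x hx,
    hk _ (hst hx), Function.comp_apply]

theorem IsRelatedOn.of_leftInverse {g : E → F} {k : F → E} {s : Set E} {t : Set F} {X : E → E}
    {Y : F → F} (hg : IsRelatedOn g s X Y) (hkg : Function.LeftInverse k g) (hst : SurjOn g s t)
    (hgd : ∀ x ∈ s, DifferentiableAt ℝ g x) (hkd : ∀ y ∈ t, DifferentiableAt ℝ k y) :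
    IsRelatedOn k t Y X := by
  intro y hy
  obtain ⟨x, hx, rfl⟩ := hst hy
  have hcomp : fderiv ℝ k (g x) ∘L fderiv ℝ g x = ContinuousLinearMap.id ℝ E := by
    rw [← fderiv_comp x (hkd _ hy) (hgd x hx), hkg.comp_eq_id, fderiv_id]
  rw [← hg x hx, hkg x, ← ContinuousLinearMap.comp_apply, hcomp, ContinuousLinearMap.id_apply]

theorem IsSolution.comp_of_isRelatedOn {m N N' : ℕ} {X₀ : (Fin N → ℝ) → (Fin N → ℝ)}
    {X : Fin m → (Fin N → ℝ) → (Fin N → ℝ)} {Y₀ : (Fin N' → ℝ) → (Fin N' → ℝ)}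
    {Y : Fin m → (Fin N' → ℝ) → (Fin N' → ℝ)} {u : Lp (Fin m → ℝ) ⊤ (volume : Measure ℝ)}
    {γ : ℝ → Fin N → ℝ} {g : (Fin N → ℝ) → (Fin N' → ℝ)} {s : Set (Fin N → ℝ)}
    (hγ : IsSolution X₀ X u γ) (hγs : ∀ t, γ t ∈ s) (hg : ∀ x ∈ s, ContDiffAt ℝ 1 g x)
    (h₀ : IsRelatedOn g s X₀ Y₀) (h : ∀ i, IsRelatedOn g s (X i) (Y i)) :
    IsSolution Y₀ Y u (g ∘ γ) := by
  refine ⟨fun a b => ?_, ?_⟩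
  · have hsub : γ '' uIcc a b ⊆ s := image_subset_iff.2 fun t _ => hγs t
    exact absolutelyContinuousOnInterval_comp_of_locallyLipschitzOn
      ((locallyLipschitzOn_of_contDiffAt hg).mono hsub) (hγ.1 a b)
  · filter_upwards [hγ.2] with t ht
    have hgt := ((hg _ (hγs t)).differentiableAt one_ne_zero).hasFDerivAt.comp_hasDerivAt t ht
    simp only [map_add, map_sum, map_smul, h₀ _ (hγs t), h _ _ (hγs t)] at hgt
    exact hgt

end RelatedFields

section RadialProjection

variable {N : ℕ} {v : Fin N → ℝ}

theorem euclNorm_pos (hv : v ≠ 0) : 0 < euclNorm v := by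
  obtain ⟨i, hi⟩ := Function.ne_iff.1 hv
  exact Real.sqrt_pos.2
    (Finset.sum_pos' (fun _ _ => sq_nonneg _) ⟨i, Finset.mem_univ i, sq_pos_of_ne_zero hi⟩)

theorem euclNorm_smul (c : ℝ) (v : Fin N → ℝ) : euclNorm (c • v) = |c| * euclNorm v := by
  simp only [euclNorm, Pi.smul_apply, smul_eq_mul, mul_pow, ← Finset.mul_sum]
  rw [Real.sqrt_mul (sq_nonneg c), Real.sqrt_sq_eq_abs]

theorem contDiffAt_euclNorm {k : WithTop ℕ∞} (hv : v ≠ 0) : ContDiffAt ℝ k euclNorm v := by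
  have hsum : ContDiffAt ℝ k (fun w : Fin N → ℝ => ∑ i, w i ^ 2) v := by fun_prop
  exact hsum.sqrt (Real.sqrt_pos.1 (euclNorm_pos hv)).ne'

theorem fderiv_euclNorm_apply (hv : v ≠ 0) (w : Fin N → ℝ) :
    fderiv ℝ euclNorm v w = (v ⬝ᵥ w) / euclNorm v := by
  have hsum : HasFDerivAt (fun w : Fin N → ℝ => ∑ i, w i ^ 2)
      (∑ i, (2 * v i) • ContinuousLinearMap.proj (R := ℝ) (φ := fun _ : Fin N => ℝ) i) v :=
    HasFDerivAt.fun_sum fun i _ => by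
      simpa [Function.comp_def] using
        (hasDerivAt_pow 2 (v i)).comp_hasFDerivAt v (hasFDerivAt_apply (𝕜 := ℝ) i v)
  have hnorm : HasFDerivAt euclNorm _ v := hsum.sqrt (Real.sqrt_pos.1 (euclNorm_pos hv)).ne'
  rw [hnorm.fderiv, ← euclNorm]
  simp only [FunLike.coe_smul, FunLike.coe_sum, Pi.smul_apply, Finset.sum_apply,
    ContinuousLinearMap.proj_apply, smul_eq_mul, dotProduct, mul_assoc, ← Finset.mul_sum]
  field_simp

/-- The radial projection `v ↦ v / ‖v‖` of `ℝ^N ∖ {0}` to the unit sphere, with junk value `0`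
at `0`. -/
noncomputable def radialProj (v : Fin N → ℝ) : Fin N → ℝ := (euclNorm v)⁻¹ • v

theorem radialProj_smul {c : ℝ} (hc : 0 < c) (v : Fin N → ℝ) :
    radialProj (c • v) = radialProj v := by
  rw [radialProj, radialProj, euclNorm_smul, abs_of_pos hc, smul_smul, mul_comm c,
    mul_inv, mul_assoc, inv_mul_cancel₀ hc.ne', mul_one]

theorem contDiffAt_radialProj {k : WithTop ℕ∞} (hv : v ≠ 0) : ContDiffAt ℝ k radialProj v :=
  ((contDiffAt_euclNorm hv).inv (euclNorm_pos hv).ne').smul contDiffAt_id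

theorem fderiv_radialProj_apply (hv : v ≠ 0) (w : Fin N → ℝ) :
    fderiv ℝ radialProj v w = (euclNorm v)⁻¹ • (w - (radialProj v ⬝ᵥ w) • radialProj v) := by
  have hr : euclNorm v ≠ 0 := (euclNorm_pos hv).ne'
  have hnorm : HasFDerivAt euclNorm (fderiv ℝ euclNorm v) v :=
    ((contDiffAt_euclNorm hv).differentiableAt one_ne_zero).hasFDerivAt
  have hproj : HasFDerivAt radialProj _ v :=
    ((hasDerivAt_inv hr).comp_hasFDerivAt v hnorm).fun_smul (hasFDerivAt_id v)
  rw [hproj.fderiv]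
  ext i
  simp only [radialProj, FunLike.coe_add, FunLike.coe_smul, Pi.add_apply, Pi.sub_apply,
    Pi.smul_apply, ContinuousLinearMap.smulRight_apply, ContinuousLinearMap.id_apply,
    fderiv_euclNorm_apply hv, Function.comp_apply, smul_dotProduct, smul_eq_mul]
  field_simp
  ring

theorem isRelatedOn_radialProj (B : Matrix (Fin N) (Fin N) ℝ) :
    IsRelatedOn radialProj {0}ᶜ (fun v => B *ᵥ v) (sphereField B) := by
  intro v hv
  change fderiv ℝ radialProj v (B *ᵥ v) = sphereField B (radialProj v)
  have hB : B *ᵥ radialProj v = (euclNorm v)⁻¹ • (B *ᵥ v) := Matrix.mulVec_smul _ _ _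
  rw [fderiv_radialProj_apply hv, sphereField, hB, smul_sub, dotProduct_smul, smul_assoc]

end RadialProjection

section Hemisphere

variable {n : ℕ}

theorem extVec_ne_zero (x : Fin n → ℝ) {z : ℝ} (hz : z ≠ 0) : extVec x z ≠ 0 := fun h =>
  hz (by simpa [extVec] using congrFun h (Fin.last n))

theorem extVec_dotProduct_extVec (x y : Fin n → ℝ) (z w : ℝ) :
    extVec x z ⬝ᵥ extVec y w = x ⬝ᵥ y + z * w := by
  simp [dotProduct, Fin.sum_univ_castSucc, extVec]

theorem extMatrix_mulVec_extVec (A : Matrix (Fin n) (Fin n) ℝ) (a x : Fin n → ℝ) (z : ℝ) :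
    extMatrix A a *ᵥ extVec x z = extVec (A *ᵥ x + z • a) 0 := by
  ext i
  cases i using Fin.lastCases with
  | last => simp [Matrix.mulVec, extMatrix, extVec]
  | cast i =>
    have hrow : extMatrix A a i.castSucc = extVec (A i) (a i) := by
      ext j
      simp [extMatrix]
    rw [Matrix.mulVec, hrow, extVec_dotProduct_extVec]
    simp [extVec, Matrix.mulVec, mul_comm]

theorem contDiff_extVec {k : WithTop ℕ∞} (z : ℝ) :
    ContDiff ℝ k fun x : Fin n → ℝ => extVec x z := by
  refine contDiff_pi' fun i => ?_
  cases i using Fin.lastCases with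
  | last => simpa [extVec] using contDiff_const
  | cast i => simpa [extVec] using contDiff_apply ℝ ℝ i

theorem fderiv_extVec_apply (x : Fin n → ℝ) (z : ℝ) (w : Fin n → ℝ) :
    fderiv ℝ (fun x : Fin n → ℝ => extVec x z) x w = extVec w 0 := by
  ext i
  have hcoord : fderiv ℝ (fun y : Fin n → ℝ => extVec y z) x w i =
      fderiv ℝ (fun y : Fin n → ℝ => extVec y z i) x w := by
    rw [fderiv_apply ((contDiff_extVec z).differentiable one_ne_zero x),
      ContinuousLinearMap.comp_apply, ContinuousLinearMap.proj_apply]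
  rw [hcoord]
  cases i using Fin.lastCases with
  | last => simp [extVec]
  | cast i => simp [extVec, (hasFDerivAt_apply (𝕜 := ℝ) i x).fderiv]

theorem isRelatedOn_extVec_one (A : Matrix (Fin n) (Fin n) ℝ) (a : Fin n → ℝ) :
    IsRelatedOn (fun x => extVec x 1) univ (fun x => A *ᵥ x + a)
      (fun v => extMatrix A a *ᵥ v) := by
  intro x _
  simp only [fderiv_extVec_apply, extMatrix_mulVec_extVec, one_smul]

theorem coe_hemisphereMap (x : Fin n → ℝ) :
    (hemisphereMap x : Fin (n + 1) → ℝ) = radialProj (extVec x 1) :=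
  rfl

theorem contDiff_coe_hemisphereMap {k : WithTop ℕ∞} :
    ContDiff ℝ k fun x : Fin n → ℝ => (hemisphereMap x : Fin (n + 1) → ℝ) :=
  contDiff_iff_contDiffAt.2 fun x =>
    ContDiffAt.comp (g := radialProj) x (contDiffAt_radialProj (extVec_ne_zero x one_ne_zero))
      (contDiff_extVec 1).contDiffAt

theorem isRelatedOn_coe_hemisphereMap (A : Matrix (Fin n) (Fin n) ℝ) (a : Fin n → ℝ) :
    IsRelatedOn (fun x : Fin n → ℝ => (hemisphereMap x : Fin (n + 1) → ℝ)) univ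
      (fun x => A *ᵥ x + a) (sphereField (extMatrix A a)) :=
  (isRelatedOn_radialProj (extMatrix A a)).comp (isRelatedOn_extVec_one A a)
    (fun x _ => extVec_ne_zero x one_ne_zero)
    (fun _ hv => (contDiffAt_radialProj hv).differentiableAt one_ne_zero)
    fun x _ => (contDiff_extVec 1).differentiable one_ne_zero x

/-- The central projection `s ↦ (s_1, …, s_n) / s_{n+1}`, the inverse of `hemisphereMap` on the
open northern hemisphere; it is `0` on the equator, since `x / 0 = 0`. -/
noncomputable def centralProj (s : Fin (n + 1) → ℝ) : Fin n → ℝ :=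
  fun i => s i.castSucc / s (Fin.last n)

theorem centralProj_smul {c : ℝ} (hc : c ≠ 0) (s : Fin (n + 1) → ℝ) :
    centralProj (c • s) = centralProj s :=
  funext fun _ => mul_div_mul_left _ _ hc

theorem extVec_centralProj_one {s : Fin (n + 1) → ℝ} (hs : s (Fin.last n) ≠ 0) :
    extVec (centralProj s) 1 = (s (Fin.last n))⁻¹ • s := by
  ext i
  cases i using Fin.lastCases with
  | last => simp [extVec, hs]
  | cast i => simp [extVec, centralProj, div_eq_inv_mul]

theorem contDiffAt_centralProj {k : WithTop ℕ∞} {s : Fin (n + 1) → ℝ} (hs : s (Fin.last n) ≠ 0) :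
    ContDiffAt ℝ k centralProj s :=
  contDiffAt_pi.2 fun i =>
    (contDiff_apply ℝ ℝ i.castSucc).contDiffAt.div (contDiff_apply ℝ ℝ (Fin.last n)).contDiffAt hs

theorem centralProj_hemisphereMap (x : Fin n → ℝ) :
    centralProj (hemisphereMap x : Fin (n + 1) → ℝ) = x := by
  rw [coe_hemisphereMap, radialProj,
    centralProj_smul (inv_ne_zero (euclNorm_pos (extVec_ne_zero x one_ne_zero)).ne')]
  ext i
  simp [centralProj, extVec]

theorem hemisphereMap_centralProj (s : NorthHemisphere n) :
    hemisphereMap (centralProj (s : Fin (n + 1) → ℝ)) = s := by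
  obtain ⟨s, hs, hpos⟩ := s
  have hnorm : euclNorm s = 1 := by rw [euclNorm, hs, Real.sqrt_one]
  apply Subtype.ext
  rw [coe_hemisphereMap, extVec_centralProj_one hpos.ne', radialProj_smul (inv_pos.2 hpos),
    radialProj, hnorm, inv_one, one_smul]

/-- The map `h : ℝ^n → S^{n,+}` as a homeomorphism, with the central projection as inverse. -/
noncomputable def hemisphereHomeomorph (n : ℕ) : (Fin n → ℝ) ≃ₜ NorthHemisphere n where
  toFun := hemisphereMap
  invFun s := centralProj (s : Fin (n + 1) → ℝ)
  left_inv := centralProj_hemisphereMap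
  right_inv := hemisphereMap_centralProj
  continuous_toFun := (contDiff_coe_hemisphereMap (k := 0)).continuous.subtype_mk _
  continuous_invFun := continuous_iff_continuousAt.2 fun s =>
    (contDiffAt_centralProj (k := 0) s.2.2.ne').continuousAt.comp
      continuous_subtype_val.continuousAt

theorem surjOn_coe_hemisphereMap :
    SurjOn (fun x : Fin n → ℝ => (hemisphereMap x : Fin (n + 1) → ℝ)) univ (NorthHemisphere n) :=
  fun s hs =>
    ⟨centralProj s, mem_univ _, congrArg Subtype.val (hemisphereMap_centralProj ⟨s, hs⟩)⟩

theorem isRelatedOn_centralProj (A : Matrix (Fin n) (Fin n) ℝ) (a : Fin n → ℝ) :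
    IsRelatedOn centralProj (NorthHemisphere n) (sphereField (extMatrix A a))
      (fun x => A *ᵥ x + a) :=
  (isRelatedOn_coe_hemisphereMap A a).of_leftInverse centralProj_hemisphereMap
    surjOn_coe_hemisphereMap
    (fun x _ => contDiff_coe_hemisphereMap.differentiable one_ne_zero x)
    fun _ hs => (contDiffAt_centralProj hs.2.ne').differentiableAt one_ne_zero

variable {m : ℕ} (Ω : Set (Fin m → ℝ)) (A₀ : Matrix (Fin n) (Fin n) ℝ) (a₀ : Fin n → ℝ)
  (A : Fin m → Matrix (Fin n) (Fin n) ℝ) (a : Fin m → Fin n → ℝ)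

theorem mapsTrajectories_hemisphereMap :
    MapsTrajectories (AffineTraj Ω A₀ a₀ A a) (HemisphereTraj Ω A₀ a₀ A a) hemisphereMap := by
  intro u γ hγ
  exact IsSolution.comp_of_isRelatedOn (γ := γ) (s := univ)
    (g := fun x => (hemisphereMap x : Fin (n + 1) → ℝ)) hγ (fun _ => mem_univ _)
    (fun _ _ => contDiff_coe_hemisphereMap.contDiffAt) (isRelatedOn_coe_hemisphereMap A₀ a₀)
    fun i => isRelatedOn_coe_hemisphereMap (A i) (a i)

theorem mapsTrajectories_centralProj :
    MapsTrajectories (HemisphereTraj Ω A₀ a₀ A a) (AffineTraj Ω A₀ a₀ A a)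
      fun s => centralProj (s : Fin (n + 1) → ℝ) :=
  fun _ σ hσ => IsSolution.comp_of_isRelatedOn hσ (fun t => (σ t).2)
    (fun _ hs => contDiffAt_centralProj hs.2.ne') (isRelatedOn_centralProj A₀ a₀)
    fun i => isRelatedOn_centralProj (A i) (a i)

end Hemisphere

theorem mainTheorem1_general {n m : ℕ} (Ω : Set (Fin m → ℝ))
    (A₀ : Matrix (Fin n) (Fin n) ℝ) (a₀ : Fin n → ℝ)
    (A : Fin m → Matrix (Fin n) (Fin n) ℝ) (a : Fin m → Fin n → ℝ)
    (F : Set (NorthHemisphere n)) :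
    IsStrongChainControlSet (HemisphereTraj Ω A₀ a₀ A a) F ↔
      ∃ E : Set (Fin n → ℝ),
        IsStrongChainControlSet (AffineTraj Ω A₀ a₀ A a) E ∧ F = hemisphereMap '' E :=
  isStrongChainControlSet_iff_exists_image (hemisphereHomeomorph n)
    (mapsTrajectories_hemisphereMap Ω A₀ a₀ A a) (mapsTrajectories_centralProj Ω A₀ a₀ A a) F

theorem mainTheorem1 {n m : ℕ} (Ω : Set (Fin m → ℝ)) (hΩ_conv : Convex ℝ Ω)
    (hΩ_comp : IsCompact Ω) (hΩ_nhds : Ω ∈ nhds (0 : Fin m → ℝ))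
    (A₀ : Matrix (Fin n) (Fin n) ℝ) (a₀ : Fin n → ℝ)
    (A : Fin m → Matrix (Fin n) (Fin n) ℝ) (a : Fin m → Fin n → ℝ)
    (F : Set (NorthHemisphere n)) :
    IsStrongChainControlSet (HemisphereTraj Ω A₀ a₀ A a) F ↔
      ∃ E : Set (Fin n → ℝ),
        IsStrongChainControlSet (AffineTraj Ω A₀ a₀ A a) E ∧ F = hemisphereMap '' E :=
  mainTheorem1_general Ω A₀ a₀ A a F
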